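/- Let $n\ge 0$ and let $\theta:[0,\infty)\to(0,\infty)$ be positive, bounded and continuous, and suppose that there is some $L\ge 0$ such that $\theta$ is non-increasing on $[L,\infty)$. Put $p(x,y)=\theta(|y-x|)$ for $x,y\in\mathbb{R}^n$, where $|\cdot|$ is the Euclidean norm. Let $\mu,\nu$ be Borel probability measures on $\mathbb{R}^n$. A solution of the Schrödinger system is a pair $(\mathsf a,\mathsf b)$ of $\sigma$-finite nonnegative Borel measures on $\mathbb{R}^n$ such that $$\mathsf a(dx)\int_{\mathbb{R}^n} p(x,y)\,\mathsf b(dy)=\mu(dx),\qquad \mathsf b(dy)\int_{\mathbb{R}^n} p(x,y)\,\mathsf a(dx)=\nu(dy).$$ Then the Schrödinger system admits a solution, and it is unique up to the trivial transformations $(\mathsf a,\mathsf b)\mapsto(\kappa^{-1}\mathsf a,\kappa\,\mathsf b)$, $\kappa>0$: there is a solution $(\mathsf a,\mathsf b)$ such that the solutions are exactly the pairs $(\kappa^{-1}\mathsf a,\kappa\,\mathsf b)$ with $0<\kappa<\infty$. Moreover, there is exactly one measure $\pi$ on $\mathbb{R}^n\times\mathbb{R}^n$ of the form $\pi(dx\,dy)=p(x,y)\,\mathsf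 a(dx)\,\mathsf b(dy)$ with $(\mathsf a,\mathsf b)$ a solution. -/

import Mathlib

open MeasureTheory Set
open scoped ENNReal NNReal

/-- The pair `(a, b)` of σ-finite nonnegative measures solves the Schrödinger system
`a(dx) ∫ p(x,y) b(dy) = μ(dx)`, `b(dy) ∫ p(x,y) a(dx) = ν(dy)`
with nonnegative transition density `p` and marginals `μ`, `ν`. -/
structure IsSchrodingerSolution {X Y : Type*} [MeasurableSpace X] [MeasurableSpace Y]
    (p : X → Y → ℝ≥0∞) (μ : Measure X) (ν : Measure Y)
    (a : Measure X) (b : Measure Y) : Prop where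
  sigmaFinite_left : SigmaFinite a
  sigmaFinite_right : SigmaFinite b
  left_eq : a.withDensity (fun x => ∫⁻ y, p x y ∂b) = μ
  right_eq : b.withDensity (fun y => ∫⁻ x, p x y ∂a) = ν

/-- The measure `p(x,y) a(dx) b(dy)` on the product space. -/
noncomputable def schrodingerMeasure {X Y : Type*} [MeasurableSpace X] [MeasurableSpace Y]
    (p : X → Y → ℝ≥0∞) (a : Measure X) (b : Measure Y) : Measure (X × Y) :=
  (a.prod b).withDensity (fun z => p z.1 z.2)

/-- The transition density `p(x,y) = θ(|y - x|)` on `ℝⁿ`, with the Euclidean norm. -/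
noncomputable def radialDensity (n : ℕ) (θ : ℝ → ℝ) (x y : EuclideanSpace ℝ (Fin n)) : ℝ≥0∞ :=
  ENNReal.ofReal (θ ‖y - x‖)

/-!
A measure `π` on `X × Y` has the form `p(x, y) a(dx) b(dy)` essentially when the measure
`p(x, y') p(x', y) π(dx dy) π(dx' dy')` is invariant under the exchange of `y` and `y'`
(`SwapBalanced`). One direction is a symmetry of the density
(`swapBalanced_schrodingerMeasure`). Conversely, invariance makes `m = π / p` satisfy
`m(A × B) m(A' × B') = m(A × B') m(A' × B)`, so fixing one rectangle `A' × B'` of positive finite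
mass exhibits `m` as a product (`SwapBalanced.exists_eq_schrodingerMeasure`). For a bounded
continuous kernel the invariance is stable under weak convergence (`SwapBalanced.of_tendsto`).

*Existence.* For finitely supported marginals the Schrödinger system is the problem of scaling a
positive matrix to given row and column sums, solved by minimising a coercive dual functional
(`exists_matrix_scaling`). General `μ` and `ν` are weak limits of finitely supported measures; the
corresponding couplings are tight because their marginals are, and any weak limit point (Prokhorov)
is a swap-balanced coupling of `μ` and `ν`, hence comes from a solution
(`exists_isSchrodingerSolution`). Positivity and continuity of `p` on compact sets give the
σ-finiteness of `a` and `b`.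

*Uniqueness.* Two solutions have densities `α, α'` against `μ` and `β, β'` against `ν`. With the
bounded functions `h = α' / (α + α')` and `k = β / (β + β')`, equality of the marginals gives
`∫ (h(x) - k(y)) d(π' - π) = 0`, whose integrand against `μ ⊗ ν` is
`p (α'β' - αβ)² / ((α + α') (β + β')) ≥ 0`. Therefore `α'β' = αβ` almost everywhere
(`ae_mul_eq_mul_of_marginals_eq`). This replaces the usual relative entropy argument and requires no
integrability of logarithms.
-/

open Filter Topology

/-! ### Exchanging the second coordinates -/

section Swap

variable {X Y : Type*}

/-- The involution of `(X × Y) × (X × Y)` exchanging the two second coordinates. -/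
def swapSnd (w : (X × Y) × (X × Y)) : (X × Y) × (X × Y) :=
  ((w.1.1, w.2.2), (w.2.1, w.1.2))

variable [MeasurableSpace X] [MeasurableSpace Y]

@[fun_prop]
lemma measurable_swapSnd : Measurable (swapSnd : (X × Y) × (X × Y) → (X × Y) × (X × Y)) := by
  unfold swapSnd; fun_prop

lemma measurePreserving_swapSnd_prod (a : Measure X) (b : Measure Y) [SFinite a] [SFinite b] :
    MeasurePreserving swapSnd ((a.prod b).prod (a.prod b)) ((a.prod b).prod (a.prod b)) := by
  have h1 := measurePreserving_prodAssoc a b (a.prod b)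
  have h2 : MeasurePreserving Prod.swap (b.prod (a.prod b)) ((a.prod b).prod b) :=
    Measure.measurePreserving_swap
  have h3 := measurePreserving_prodAssoc a b b
  have h4 : MeasurePreserving (Prod.map id Prod.swap) (a.prod (b.prod b)) (a.prod (b.prod b)) :=
    (MeasurePreserving.id a).prod Measure.measurePreserving_swap
  have h5 : MeasurePreserving Prod.swap ((a.prod b).prod b) (b.prod (a.prod b)) :=
    Measure.measurePreserving_swap
  have h6 := (MeasurePreserving.id a).prod (h5.comp (h3.symm.comp (h4.comp (h3.comp h2))))
  exact h1.symm.comp (h6.comp h1)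

lemma map_swapSnd_withDensity {Q : Measure ((X × Y) × (X × Y))} (hQ : Q.map swapSnd = Q)
    {F : (X × Y) × (X × Y) → ℝ≥0∞} (hF : Measurable F) (hs : ∀ w, F (swapSnd w) = F w) :
    (Q.withDensity F).map swapSnd = Q.withDensity F := by
  refine Measure.ext_of_lintegral _ fun f hf ↦ ?_
  rw [lintegral_map hf measurable_swapSnd,
    lintegral_withDensity_eq_lintegral_mul (g := fun w ↦ f (swapSnd w)) _ hF
      (hf.comp measurable_swapSnd),
    lintegral_withDensity_eq_lintegral_mul _ hF hf]
  conv_rhs => rw [← hQ, lintegral_map (hF.mul hf) measurable_swapSnd]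
  simp [hs]

/-- The weight `p(x, y') p(x', y)` at the pair of points `(x, y)`, `(x', y')`. -/
noncomputable def crossWeight (p : X → Y → ℝ≥0∞) (w : (X × Y) × (X × Y)) : ℝ≥0∞ :=
  p w.1.1 w.2.2 * p w.2.1 w.1.2

/-- A measure `π` on `X × Y` is *swap-balanced* for `p` if the measure
`p(x, y') p(x', y) π(dx dy) π(dx' dy')` does not change when `y` and `y'` are exchanged. -/
def SwapBalanced (p : X → Y → ℝ≥0∞) (π : Measure (X × Y)) : Prop :=
  ((π.prod π).withDensity (crossWeight p)).map swapSnd = (π.prod π).withDensity (crossWeight p)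

variable {p : X → Y → ℝ≥0∞}

lemma measurable_crossWeight (hp : Measurable (Function.uncurry p)) :
    Measurable (crossWeight p) := by
  have h1 : Measurable fun w : (X × Y) × (X × Y) ↦ Function.uncurry p (w.1.1, w.2.2) := by fun_prop
  have h2 : Measurable fun w : (X × Y) × (X × Y) ↦ Function.uncurry p (w.2.1, w.1.2) := by fun_prop
  exact h1.mul h2

/-- Against `a ⊗ b ⊗ a ⊗ b`, the measure in the definition of `SwapBalanced` has density
`p(x, y) p(x', y') p(x, y') p(x', y)`, which is symmetric. -/
lemma swapBalanced_schrodingerMeasure (hp : Measurable (Function.uncurry p)) (a : Measure X)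
    (b : Measure Y) [SFinite a] [SFinite b] : SwapBalanced p (schrodingerMeasure p a b) := by
  have hp' : Measurable fun z : X × Y ↦ p z.1 z.2 := hp
  have hm := measurable_crossWeight hp
  have hpp : Measurable fun w : (X × Y) × (X × Y) ↦ p w.1.1 w.1.2 * p w.2.1 w.2.2 :=
    (hp'.comp measurable_fst).mul (hp'.comp measurable_snd)
  unfold SwapBalanced schrodingerMeasure
  rw [prod_withDensity hp' hp', ← withDensity_mul _ hpp hm]
  refine map_swapSnd_withDensity (measurePreserving_swapSnd_prod a b).map_eq (hpp.mul hm)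
    fun w ↦ ?_
  simp only [swapSnd, crossWeight, Pi.mul_apply]
  ring

/-- For a swap-balanced `π`, all cross ratios of rectangles are trivial for `m = π / p`: dividing
`p(x, y') p(x', y) π(dx dy) π(dx' dy')` by the product of the four values of `p`, which is invariant
under the exchange, shows that `m ⊗ m` is invariant too. -/
lemma SwapBalanced.withDensity_inv_rect {π : Measure (X × Y)} [SFinite π]
    (h : SwapBalanced p π) (hp : Measurable (Function.uncurry p))
    (h0 : ∀ x y, p x y ≠ 0) (htop : ∀ x y, p x y ≠ ∞)
    {A A' : Set X} {B B' : Set Y} (hA : MeasurableSet A) (hA' : MeasurableSet A')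
    (hB : MeasurableSet B) (hB' : MeasurableSet B') :
    let m := π.withDensity fun z ↦ (p z.1 z.2)⁻¹
    m (A ×ˢ B) * m (A' ×ˢ B') = m (A ×ˢ B') * m (A' ×ˢ B) := by
  intro m
  have hp' : Measurable fun z : X × Y ↦ p z.1 z.2 := hp
  have hi : Measurable fun z : X × Y ↦ (p z.1 z.2)⁻¹ := hp'.inv
  have hm := measurable_crossWeight hp
  have hpp : Measurable fun w : (X × Y) × (X × Y) ↦ (p w.1.1 w.1.2)⁻¹ * (p w.2.1 w.2.2)⁻¹ :=
    (hi.comp measurable_fst).mul (hi.comp measurable_snd)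
  have hF : Measurable fun w ↦
      (crossWeight p w)⁻¹ * ((p w.1.1 w.1.2)⁻¹ * (p w.2.1 w.2.2)⁻¹) := hm.inv.mul hpp
  have hmm : m.prod m = ((π.prod π).withDensity (crossWeight p)).withDensity
      (fun w ↦ (crossWeight p w)⁻¹ * ((p w.1.1 w.1.2)⁻¹ * (p w.2.1 w.2.2)⁻¹)) := by
    rw [← withDensity_mul _ hm hF, prod_withDensity hi hi]
    congr 1
    ext w
    have h1 : crossWeight p w ≠ 0 := mul_ne_zero (h0 _ _) (h0 _ _)
    have h2 : crossWeight p w ≠ ∞ := ENNReal.mul_ne_top (htop _ _) (htop _ _)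
    rw [Pi.mul_apply, ← mul_assoc, ENNReal.mul_inv_cancel h1 h2, one_mul]
  have hsw : (m.prod m).map swapSnd = m.prod m := by
    rw [hmm]
    refine map_swapSnd_withDensity h hF fun w ↦ ?_
    simp only [swapSnd, crossWeight]
    rw [ENNReal.mul_inv (.inl (h0 _ _)) (.inl (htop _ _)),
      ENNReal.mul_inv (.inl (h0 _ _)) (.inl (htop _ _))]
    ring
  rw [← Measure.prod_prod, ← hsw, Measure.map_apply measurable_swapSnd
    ((hA.prod hB).prod (hA'.prod hB')), ← Measure.prod_prod]
  congr 1
  ext w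
  simp only [swapSnd, mem_preimage, mem_prod]
  tauto

lemma map_fst_schrodingerMeasure (hp : Measurable (Function.uncurry p)) (a : Measure X)
    (b : Measure Y) [SFinite a] [SFinite b] :
    (schrodingerMeasure p a b).map Prod.fst = a.withDensity fun x ↦ ∫⁻ y, p x y ∂b := by
  have hp' : Measurable fun z : X × Y ↦ p z.1 z.2 := hp
  refine Measure.ext_of_lintegral _ fun f hf ↦ ?_
  have hφ : Measurable fun x ↦ ∫⁻ y, p x y ∂b := hp'.lintegral_prod_right'
  have hf' : Measurable fun z : X × Y ↦ f z.1 := hf.comp measurable_fst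
  rw [lintegral_map hf measurable_fst, schrodingerMeasure,
    lintegral_withDensity_eq_lintegral_mul _ hp' hf',
    lintegral_withDensity_eq_lintegral_mul _ hφ hf,
    lintegral_prod _ (hp'.mul hf').aemeasurable]
  refine lintegral_congr fun x ↦ ?_
  simp only [Pi.mul_apply]
  exact lintegral_mul_const _ hp.of_uncurry_left

lemma map_snd_schrodingerMeasure (hp : Measurable (Function.uncurry p)) (a : Measure X)
    (b : Measure Y) [SFinite a] [SFinite b] :
    (schrodingerMeasure p a b).map Prod.snd = b.withDensity fun y ↦ ∫⁻ x, p x y ∂a := by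
  have hp' : Measurable fun z : X × Y ↦ p z.1 z.2 := hp
  refine Measure.ext_of_lintegral _ fun f hf ↦ ?_
  have hφ : Measurable fun y ↦ ∫⁻ x, p x y ∂a := hp'.lintegral_prod_left'
  have hf' : Measurable fun z : X × Y ↦ f z.2 := hf.comp measurable_snd
  rw [lintegral_map hf measurable_snd, schrodingerMeasure,
    lintegral_withDensity_eq_lintegral_mul _ hp' hf',
    lintegral_withDensity_eq_lintegral_mul _ hφ hf,
    lintegral_prod_symm _ (hp'.mul hf').aemeasurable]
  refine lintegral_congr fun y ↦ ?_
  simp only [Pi.mul_apply]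
  exact lintegral_mul_const _ hp.of_uncurry_right

/-- If `X` and `Y` are covered by countably many sets whose products have finite measure under
`m = π / p`, then a nonzero swap-balanced `π` is of the form `p(x, y) a(dx) b(dy)`. One of these
products, say `A' × B'`, has positive `m`-measure, and one may take `a(A) = m(A × B')` and
`b(B) = m(A' × B) / m(A' × B')`. -/
lemma SwapBalanced.exists_eq_schrodingerMeasure {π : Measure (X × Y)} [SFinite π]
    (h : SwapBalanced p π) (hp : Measurable (Function.uncurry p))
    (h0 : ∀ x y, p x y ≠ 0) (htop : ∀ x y, p x y ≠ ∞)
    {K : ℕ → Set X} {K' : ℕ → Set Y} (hK : ∀ n, MeasurableSet (K n))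
    (hK' : ∀ n, MeasurableSet (K' n)) (hKU : ⋃ n, K n = univ) (hKU' : ⋃ n, K' n = univ)
    (hfin : ∀ i j, π.withDensity (fun z ↦ (p z.1 z.2)⁻¹) (K i ×ˢ K' j) ≠ ∞) (hπ : π ≠ 0) :
    ∃ (a : Measure X) (b : Measure Y), SigmaFinite a ∧ SigmaFinite b ∧
      π = schrodingerMeasure p a b := by
  have hp' : Measurable fun z : X × Y ↦ p z.1 z.2 := hp
  have hi : Measurable fun z : X × Y ↦ (p z.1 z.2)⁻¹ := hp'.inv
  have hrect := @SwapBalanced.withDensity_inv_rect _ _ _ _ p π _ h hp h0 htop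
  set m := π.withDensity fun z ↦ (p z.1 z.2)⁻¹ with hm
  have hπm : π = m.withDensity fun z ↦ p z.1 z.2 := by
    have := withDensity_inv_same (μ := π) hi
      (.of_forall fun z ↦ by simpa using htop z.1 z.2) (.of_forall fun z ↦ by simpa using h0 z.1 z.2)
    simpa using this.symm
  obtain ⟨i, j, hij⟩ : ∃ i j, m (K i ×ˢ K' j) ≠ 0 := by
    by_contra! hc
    have hu : (univ : Set (X × Y)) = ⋃ i, ⋃ j, K i ×ˢ K' j := by
      rw [← univ_prod_univ, ← hKU, ← hKU']
      simp only [iUnion_prod_const, prod_iUnion]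
      exact iUnion_comm _
    have : m = 0 := by
      rw [← Measure.measure_univ_eq_zero, hu]
      simp [hc]
    exact hπ (by rw [hπm, this]; simp)
  have hij' := hfin i j
  set A' := K i
  set B' := K' j
  set c := m (A' ×ˢ B') with hc
  let a : Measure X := (m.restrict (Prod.snd ⁻¹' B')).map Prod.fst
  let b : Measure Y := c⁻¹ • (m.restrict (Prod.fst ⁻¹' A')).map Prod.snd
  have ha : ∀ A, MeasurableSet A → a A = m (A ×ˢ B') := fun A hA ↦ by
    rw [Measure.map_apply measurable_fst hA, Measure.restrict_apply (measurable_fst hA)]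
    rfl
  have hb : ∀ B, MeasurableSet B → b B = c⁻¹ * m (A' ×ˢ B) := fun B hB ↦ by
    rw [Measure.smul_apply, Measure.map_apply measurable_snd hB,
      Measure.restrict_apply (measurable_snd hB), inter_comm]
    rfl
  have sa : SigmaFinite a := ⟨⟨K, fun _ ↦ trivial, fun n ↦ by
    rw [ha _ (hK n)]; exact (hfin n j).lt_top, hKU⟩⟩
  have sb : SigmaFinite b := ⟨⟨K', fun _ ↦ trivial, fun n ↦ by
    rw [hb _ (hK' n)]
    exact (ENNReal.mul_ne_top (ENNReal.inv_ne_top.2 hij) (hfin i n)).lt_top, hKU'⟩⟩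
  refine ⟨a, b, sa, sb, ?_⟩
  have hab : a.prod b = m := Measure.prod_eq fun A B hA hB ↦ by
    rw [ha A hA, hb B hB, mul_left_comm, ← hrect hA (hK i) hB (hK' j), mul_left_comm,
      ENNReal.inv_mul_cancel hij hij', mul_one]
  rw [schrodingerMeasure, hab]
  exact hπm

end Swap

/-! ### Marginals and uniqueness -/

section Uniqueness

variable {X Y : Type*} [MeasurableSpace X] [MeasurableSpace Y]

/-- Two couplings with densities `q α β` and `q α' β'` against `ρ` and equal marginals agree. With
`h = α' / (α + α')` and `k = β / (β + β')`, the function `h(x) - k(y)` has the same integral under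
both couplings, while `(h - k) (α'β' - αβ) = (α'β' - αβ)² / ((α + α') (β + β')) ≥ 0`. Both `h` and
`k` are bounded, so no integrability of `log α` or `log β` is needed. -/
lemma ae_mul_eq_mul_of_marginals_eq {ρ : Measure (X × Y)} {q : X × Y → ℝ} {α α' : X → ℝ}
    {β β' : Y → ℝ} (hq : Measurable q) (hα : Measurable α) (hα' : Measurable α')
    (hβ : Measurable β) (hβ' : Measurable β') (q0 : ∀ z, 0 < q z) (α0 : ∀ x, 0 < α x)
    (α0' : ∀ x, 0 < α' x) (β0 : ∀ y, 0 < β y) (β0' : ∀ y, 0 < β' y)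
    {π π' : Measure (X × Y)} [IsFiniteMeasure π] [IsFiniteMeasure π']
    (hπ : π = ρ.withDensity fun z ↦ ENNReal.ofReal (q z * (α z.1 * β z.2)))
    (hπ' : π' = ρ.withDensity fun z ↦ ENNReal.ofReal (q z * (α' z.1 * β' z.2)))
    (hfst : π.map Prod.fst = π'.map Prod.fst) (hsnd : π.map Prod.snd = π'.map Prod.snd) :
    ∀ᵐ z ∂ρ, α' z.1 * β' z.2 = α z.1 * β z.2 := by
  set h : X → ℝ := fun x ↦ α' x / (α x + α' x) with hh
  set k : Y → ℝ := fun y ↦ β y / (β y + β' y) with hk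
  have hhm : Measurable h := by fun_prop
  have hkm : Measurable k := by fun_prop
  have hb : ∀ x, ‖h x‖ ≤ 1 := fun x ↦ by
    have := α0 x; have := α0' x
    rw [Real.norm_of_nonneg (by positivity), div_le_one (by positivity)]; linarith
  have kb : ∀ y, ‖k y‖ ≤ 1 := fun y ↦ by
    have := β0 y; have := β0' y
    rw [Real.norm_of_nonneg (by positivity), div_le_one (by positivity)]; linarith
  have hi : ∀ (τ : Measure (X × Y)) [IsFiniteMeasure τ], Integrable (fun z ↦ h z.1) τ :=
    fun τ _ ↦ .of_bound (hhm.comp measurable_fst).aestronglyMeasurable 1 (.of_forall fun z ↦ hb _)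
  have ki : ∀ (τ : Measure (X × Y)) [IsFiniteMeasure τ], Integrable (fun z ↦ k z.2) τ :=
    fun τ _ ↦ .of_bound (hkm.comp measurable_snd).aestronglyMeasurable 1 (.of_forall fun z ↦ kb _)
  have e1 : ∫ z, h z.1 ∂π = ∫ z, h z.1 ∂π' := by
    rw [← integral_map (φ := Prod.fst) (f := h) measurable_fst.aemeasurable
      hhm.aestronglyMeasurable, hfst, integral_map measurable_fst.aemeasurable
      hhm.aestronglyMeasurable]
  have e2 : ∫ z, k z.2 ∂π = ∫ z, k z.2 ∂π' := by
    rw [← integral_map (φ := Prod.snd) (f := k) measurable_snd.aemeasurable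
      hkm.aestronglyMeasurable, hsnd, integral_map measurable_snd.aemeasurable
      hkm.aestronglyMeasurable]
  have e : ∫ z, (h z.1 - k z.2) ∂π = ∫ z, (h z.1 - k z.2) ∂π' := by
    rw [integral_sub (hi π) (ki π), integral_sub (hi π') (ki π'), e1, e2]
  have hW : ∀ (α : X → ℝ) (β : Y → ℝ), Measurable α → Measurable β →
      Measurable fun z : X × Y ↦ ENNReal.ofReal (q z * (α z.1 * β z.2)) := by
    intro α β _ _; fun_prop
  have I := ((hi π).sub (ki π))
  have I' := ((hi π').sub (ki π'))
  have fin : ∀ (α : X → ℝ) (β : Y → ℝ),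
      ∀ᵐ z ∂ρ, ENNReal.ofReal (q z * (α z.1 * β z.2)) < ∞ := fun α β ↦ .of_forall fun z ↦ by simp
  rw [hπ, integrable_withDensity_iff_integrable_smul' (hW α β hα hβ) (fin α β)] at I
  rw [hπ', integrable_withDensity_iff_integrable_smul' (hW α' β' hα' hβ') (fin α' β')] at I'
  rw [hπ, hπ', integral_withDensity_eq_integral_toReal_smul (hW α β hα hβ) (fin α β),
    integral_withDensity_eq_integral_toReal_smul (hW α' β' hα' hβ') (fin α' β')] at e
  have J := I'.sub I
  have hJ0 := integral_sub I' I
  simp only [Pi.sub_apply] at hJ0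
  rw [e, sub_self] at hJ0
  have key : ∀ z : X × Y, (ENNReal.ofReal (q z * (α' z.1 * β' z.2))).toReal • (h z.1 - k z.2) -
      (ENNReal.ofReal (q z * (α z.1 * β z.2))).toReal • (h z.1 - k z.2) =
      q z * (α' z.1 * β' z.2 - α z.1 * β z.2) ^ 2 /
        ((α z.1 + α' z.1) * (β z.2 + β' z.2)) := fun z ↦ by
    have := q0 z; have := α0 z.1; have := α0' z.1; have := β0 z.2; have := β0' z.2
    rw [ENNReal.toReal_ofReal (by positivity), ENNReal.toReal_ofReal (by positivity)]
    simp only [hh, hk, smul_eq_mul]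
    field_simp
    ring
  have nn : ∀ z : X × Y, 0 ≤ q z * (α' z.1 * β' z.2 - α z.1 * β z.2) ^ 2 /
        ((α z.1 + α' z.1) * (β z.2 + β' z.2)) := fun z ↦ by
    have := q0 z; have := α0 z.1; have := α0' z.1; have := β0 z.2; have := β0' z.2
    positivity
  simp only [key] at hJ0
  have J' : Integrable (fun z : X × Y ↦ q z * (α' z.1 * β' z.2 - α z.1 * β z.2) ^ 2 /
        ((α z.1 + α' z.1) * (β z.2 + β' z.2))) ρ :=
    J.congr (.of_forall fun z ↦ key z)
  rw [integral_eq_zero_iff_of_nonneg nn J'] at hJ0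
  filter_upwards [hJ0] with z hz
  have := q0 z; have := α0 z.1; have := α0' z.1; have := β0 z.2; have := β0' z.2
  have hd : (α z.1 + α' z.1) * (β z.2 + β' z.2) ≠ 0 := by positivity
  simp only [Pi.zero_apply, div_eq_zero_iff, hd, or_false, mul_eq_zero, (q0 z).ne', false_or] at hz
  exact sub_eq_zero.1 (pow_eq_zero_iff two_ne_zero |>.1 hz)

/-- If `a(dx) φ(x) = μ(dx)` is finite and `φ > 0`, then `a` has a positive, everywhere finite
density against `μ`. -/
lemma exists_pos_density_of_withDensity_eq {a μ : Measure X} [IsFiniteMeasure μ] {φ : X → ℝ≥0∞}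
    (hφ : Measurable φ) (h0 : ∀ x, φ x ≠ 0) (h : a.withDensity φ = μ) :
    ∃ α : X → ℝ, Measurable α ∧ (∀ x, 0 < α x) ∧
      a = μ.withDensity fun x ↦ ENNReal.ofReal (α x) := by
  have hfin : ∀ᵐ x ∂a, φ x < ∞ := by
    refine ae_lt_top hφ ?_
    rw [← setLIntegral_univ, ← withDensity_apply _ .univ, h]
    exact measure_ne_top μ _
  -- `φ = ∞` only on a null set, where any positive value will do
  let α : X → ℝ := fun x ↦ if φ x = ∞ then 1 else (φ x)⁻¹.toReal
  refine ⟨α, ?_, fun x ↦ ?_, ?_⟩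
  · exact Measurable.ite (hφ (measurableSet_singleton _)) measurable_const hφ.inv.ennreal_toReal
  · by_cases hx : φ x = ∞
    · simp [α, hx]
    · simp only [α, hx, if_false]
      exact ENNReal.toReal_pos (by simpa using hx) (by simpa using h0 x)
  · have hac : μ ≪ a := h ▸ withDensity_absolutelyContinuous a φ
    have e := withDensity_inv_same hφ (.of_forall h0) (hfin.mono fun x hx ↦ hx.ne)
    rw [h] at e
    refine e.symm.trans (withDensity_congr_ae ?_)
    filter_upwards [hac.ae_le hfin] with x hx
    simp only [α, hx.ne, if_false]
    rw [ENNReal.ofReal_toReal (by simpa using h0 x)]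

variable {p : X → Y → ℝ≥0∞} {μ : Measure X} {ν : Measure Y} {a a' : Measure X} {b b' : Measure Y}

lemma IsSchrodingerSolution.map_fst (h : IsSchrodingerSolution p μ ν a b)
    (hp : Measurable (Function.uncurry p)) : (schrodingerMeasure p a b).map Prod.fst = μ := by
  have := h.sigmaFinite_left; have := h.sigmaFinite_right
  rw [map_fst_schrodingerMeasure hp, h.left_eq]

lemma IsSchrodingerSolution.map_snd (h : IsSchrodingerSolution p μ ν a b)
    (hp : Measurable (Function.uncurry p)) : (schrodingerMeasure p a b).map Prod.snd = ν := by
  have := h.sigmaFinite_left; have := h.sigmaFinite_right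
  rw [map_snd_schrodingerMeasure hp, h.right_eq]

lemma IsSchrodingerSolution.isProbabilityMeasure [IsProbabilityMeasure μ]
    (h : IsSchrodingerSolution p μ ν a b) (hp : Measurable (Function.uncurry p)) :
    IsProbabilityMeasure (schrodingerMeasure p a b) := by
  have : IsProbabilityMeasure ((schrodingerMeasure p a b).map Prod.fst) := by
    rw [h.map_fst hp]; infer_instance
  exact Measure.isProbabilityMeasure_of_map Prod.fst

lemma lintegral_ne_zero_of_forall_ne_zero {c : Measure X} {f : X → ℝ≥0∞} (hc : c ≠ 0)
    (hf : Measurable f) (h0 : ∀ x, f x ≠ 0) : ∫⁻ x, f x ∂c ≠ 0 := by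
  intro hz
  rw [lintegral_eq_zero_iff hf] at hz
  apply hc
  rw [← Measure.measure_univ_eq_zero]
  exact measure_mono_null (fun x _ ↦ h0 x) hz

lemma IsSchrodingerSolution.exists_densities [IsProbabilityMeasure μ] [IsProbabilityMeasure ν]
    (h : IsSchrodingerSolution p μ ν a b)
    (hp : Measurable (Function.uncurry p)) (h0 : ∀ x y, p x y ≠ 0) :
    ∃ (α : X → ℝ) (β : Y → ℝ), Measurable α ∧ Measurable β ∧ (∀ x, 0 < α x) ∧ (∀ y, 0 < β y) ∧
      a = μ.withDensity (fun x ↦ ENNReal.ofReal (α x)) ∧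
      b = ν.withDensity (fun y ↦ ENNReal.ofReal (β y)) := by
  have := h.sigmaFinite_left; have := h.sigmaFinite_right
  have hp' : Measurable fun z : X × Y ↦ p z.1 z.2 := hp
  have ha : a ≠ 0 := by
    rintro rfl; exact IsProbabilityMeasure.ne_zero μ (by simpa using h.left_eq.symm)
  have hb : b ≠ 0 := by
    rintro rfl; exact IsProbabilityMeasure.ne_zero ν (by simpa using h.right_eq.symm)
  obtain ⟨α, hα, α0, ea⟩ := exists_pos_density_of_withDensity_eq
    (hp'.lintegral_prod_right' (ν := b)) (fun x ↦ lintegral_ne_zero_of_forall_ne_zero hb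
      hp.of_uncurry_left (h0 x)) h.left_eq
  obtain ⟨β, hβ, β0, eb⟩ := exists_pos_density_of_withDensity_eq
    (hp'.lintegral_prod_left' (μ := a)) (fun y ↦ lintegral_ne_zero_of_forall_ne_zero ha
      hp.of_uncurry_right (fun x ↦ h0 x y)) h.right_eq
  exact ⟨α, β, hα, hβ, α0, β0, ea, eb⟩

/-- Uniqueness up to a scalar, for any measurable kernel with values in `(0, ∞)`: the densities
`α, α'` of `a, a'` against `μ` and `β, β'` of `b, b'` against `ν` satisfy `α' β' = α β` almost
everywhere, which forces `α' / α` and `β' / β` to be constant. -/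
theorem IsSchrodingerSolution.exists_smul_eq [IsProbabilityMeasure μ] [IsProbabilityMeasure ν]
    (h : IsSchrodingerSolution p μ ν a b) (h' : IsSchrodingerSolution p μ ν a' b')
    (hp : Measurable (Function.uncurry p)) (h0 : ∀ x y, p x y ≠ 0) (htop : ∀ x y, p x y ≠ ∞) :
    ∃ κ : ℝ≥0, 0 < κ ∧ a' = κ⁻¹ • a ∧ b' = κ • b := by
  have hp' : Measurable fun z : X × Y ↦ p z.1 z.2 := hp
  obtain ⟨α, β, hα, hβ, α0, β0, ea, eb⟩ := h.exists_densities hp h0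
  obtain ⟨α', β', hα', hβ', α0', β0', ea', eb'⟩ := h'.exists_densities hp h0
  have dens : ∀ (α : X → ℝ) (β : Y → ℝ), Measurable α → Measurable β → (∀ x, 0 < α x) →
      schrodingerMeasure p (μ.withDensity fun x ↦ ENNReal.ofReal (α x))
        (ν.withDensity fun y ↦ ENNReal.ofReal (β y)) = (μ.prod ν).withDensity
          fun z ↦ ENNReal.ofReal ((p z.1 z.2).toReal * (α z.1 * β z.2)) := by
    intro α β hα hβ α0
    rw [schrodingerMeasure, prod_withDensity hα.ennreal_ofReal hβ.ennreal_ofReal,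
      ← withDensity_mul _ (by fun_prop) hp']
    congr 1
    ext z
    rw [Pi.mul_apply, ENNReal.ofReal_mul ENNReal.toReal_nonneg, ENNReal.ofReal_toReal (htop _ _),
      ENNReal.ofReal_mul (α0 _).le, mul_comm]
  have := h.isProbabilityMeasure hp
  have := h'.isProbabilityMeasure hp
  have key := ae_mul_eq_mul_of_marginals_eq (ρ := μ.prod ν) (q := fun z ↦ (p z.1 z.2).toReal)
    (α := α) (α' := α') (β := β) (β' := β') hp'.ennreal_toReal hα hα' hβ hβ'
    (fun z ↦ ENNReal.toReal_pos (h0 _ _) (htop _ _)) α0 α0' β0 β0'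
    (π := schrodingerMeasure p a b) (π' := schrodingerMeasure p a' b')
    (by rw [ea, eb, dens α β hα hβ α0]) (by rw [ea', eb', dens α' β' hα' hβ' α0'])
    (by rw [h.map_fst hp, h'.map_fst hp]) (by rw [h.map_snd hp, h'.map_snd hp])
  have key1 := Measure.ae_ae_of_ae_prod key
  -- one good `x₀` shows that `β' / β` is a.e. constant; then every good `x`, paired with some good
  -- `y`, has `α' x / α x` equal to the inverse constant
  obtain ⟨x₀, hx₀⟩ := key1.exists
  have hx₀' := α0 x₀
  have hx₀'' := α0' x₀
  set c : ℝ := α x₀ / α' x₀ with hc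
  have c0 : 0 < c := div_pos (α0 _) (α0' _)
  have hβc : ∀ᵐ y ∂ν, β' y = c * β y := hx₀.mono fun y hy ↦ by
    rw [hc]; field_simp; linarith
  have hαc : ∀ᵐ x ∂μ, α' x = c⁻¹ * α x := key1.mono fun x hx ↦ by
    obtain ⟨y, hy, hy'⟩ := (hx.and hβc).exists
    have := β0 y
    rw [hy'] at hy
    field_simp
    nlinarith
  refine ⟨c.toNNReal, Real.toNNReal_pos.2 c0, ?_, ?_⟩
  · rw [ea', ea, ← Real.toNNReal_inv, ENNReal.smul_def, ← ENNReal.ofReal]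
    rw [← withDensity_smul _ hα.ennreal_ofReal]
    refine withDensity_congr_ae (hαc.mono fun x hx ↦ ?_)
    simp only [Pi.smul_apply, smul_eq_mul]
    rw [hx, ENNReal.ofReal_mul (by positivity)]
  · rw [eb', eb, ENNReal.smul_def, ← ENNReal.ofReal]
    rw [← withDensity_smul _ hβ.ennreal_ofReal]
    refine withDensity_congr_ae (hβc.mono fun x hx ↦ ?_)
    simp only [Pi.smul_apply, smul_eq_mul]
    rw [hx, ENNReal.ofReal_mul c0.le]

lemma schrodingerMeasure_smul_smul [SFinite a] [SFinite b] {κ : ℝ≥0} (hκ : 0 < κ) :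
    schrodingerMeasure p (κ⁻¹ • a) (κ • b) = schrodingerMeasure p a b := by
  unfold schrodingerMeasure
  rw [Measure.prod_smul_left, Measure.prod_smul_right, smul_smul, inv_mul_cancel₀ hκ.ne', one_smul]

/-- Being a solution only depends on the marginals of `p(x, y) a(dx) b(dy)`. -/
lemma isSchrodingerSolution_iff_map (hp : Measurable (Function.uncurry p)) [SigmaFinite a]
    [SigmaFinite b] : IsSchrodingerSolution p μ ν a b ↔
      (schrodingerMeasure p a b).map Prod.fst = μ ∧
        (schrodingerMeasure p a b).map Prod.snd = ν := by
  refine ⟨fun h ↦ ⟨h.map_fst hp, h.map_snd hp⟩, fun ⟨h1, h2⟩ ↦ ⟨‹_›, ‹_›, ?_, ?_⟩⟩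
  · rwa [map_fst_schrodingerMeasure hp] at h1
  · rwa [map_snd_schrodingerMeasure hp] at h2

lemma IsSchrodingerSolution.smul (h : IsSchrodingerSolution p μ ν a b)
    (hp : Measurable (Function.uncurry p)) {κ : ℝ≥0} (hκ : 0 < κ) :
    IsSchrodingerSolution p μ ν (κ⁻¹ • a) (κ • b) := by
  have := h.sigmaFinite_left; have := h.sigmaFinite_right
  rw [isSchrodingerSolution_iff_map hp, schrodingerMeasure_smul_smul hκ]
  exact ⟨h.map_fst hp, h.map_snd hp⟩

end Uniqueness

/-! ### Matrix scaling -/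

section Scaling

variable {ι κ : Type*} [Fintype ι]

/-- The dual functional of the matrix scaling problem with row sums `μ` and column sums `ν`, in the
logarithms `u` of the row factors, the optimal column factors being already substituted. -/
noncomputable def scalingFunctional [Fintype κ] (P : ι → κ → ℝ) (μ : ι → ℝ) (ν : κ → ℝ)
    (u : ι → ℝ) : ℝ :=
  ∑ j, ν j * Real.log (∑ i, P i j * Real.exp (u i)) - ∑ i, μ i * u i

variable {P : ι → κ → ℝ} {μ : ι → ℝ} {ν : κ → ℝ}

lemma sum_mul_exp_pos [Nonempty ι] (hP : ∀ i j, 0 < P i j) (u : ι → ℝ) (j : κ) :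
    0 < ∑ i, P i j * Real.exp (u i) :=
  Finset.sum_pos (fun i _ ↦ mul_pos (hP i j) (Real.exp_pos _)) Finset.univ_nonempty

variable [Fintype κ]

lemma continuous_scalingFunctional [Nonempty ι] (hP : ∀ i j, 0 < P i j) :
    Continuous (scalingFunctional P μ ν) := by
  unfold scalingFunctional
  refine .sub (continuous_finsetSum _ fun j _ ↦ continuous_const.mul ?_) (by fun_prop)
  exact Continuous.log (by fun_prop) fun u ↦ (sum_mul_exp_pos hP u j).ne'

lemma scalingFunctional_sub_const [Nonempty ι] (hP : ∀ i j, 0 < P i j)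
    (hsum : ∑ i, μ i = ∑ j, ν j) (u : ι → ℝ) (t : ℝ) :
    scalingFunctional P μ ν (fun i ↦ u i - t) = scalingFunctional P μ ν u := by
  have h1 : ∀ j, Real.log (∑ i, P i j * Real.exp (u i - t)) =
      Real.log (∑ i, P i j * Real.exp (u i)) - t := fun j ↦ by
    have : ∑ i, P i j * Real.exp (u i - t) = (∑ i, P i j * Real.exp (u i)) * Real.exp (-t) := by
      rw [Finset.sum_mul]
      exact Finset.sum_congr rfl fun i _ ↦ by rw [sub_eq_add_neg, Real.exp_add]; ring
    rw [this, Real.log_mul (sum_mul_exp_pos hP u j).ne' (Real.exp_pos _).ne', Real.log_exp]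
    ring
  simp only [scalingFunctional, h1, mul_sub, Finset.sum_sub_distrib, ← Finset.sum_mul, hsum]
  ring

/-- The functional is invariant under adding constants to `u`, and on `{max u = 0}` it is coercive,
so it attains its minimum. -/
lemma exists_forall_scalingFunctional_le [Nonempty ι] [Nonempty κ] (hP : ∀ i j, 0 < P i j)
    (hμ : ∀ i, 0 < μ i) (hν : ∀ j, 0 < ν j) (hsum : ∑ i, μ i = ∑ j, ν j) :
    ∃ u, ∀ w, scalingFunctional P μ ν u ≤ scalingFunctional P μ ν w := by
  set Φ := scalingFunctional P μ ν with hΦ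
  obtain ⟨ij, hij⟩ := Finite.exists_min fun z : ι × κ ↦ P z.1 z.2
  set c := P ij.1 ij.2
  have hc : 0 < c := hP _ _
  obtain ⟨k₀, hk₀⟩ := Finite.exists_min μ
  set M := μ k₀
  have hM : 0 < M := hμ _
  set B : ℝ := ∑ j, ν j * Real.log c
  -- large enough for `B + M R`, a lower bound of `Φ` outside the box, to exceed `Φ 0`
  set R : ℝ := max 0 ((Φ 0 - B) / M)
  have hR : Φ 0 ≤ B + M * R := by
    have : (Φ 0 - B) / M ≤ R := le_max_right _ _
    rw [div_le_iff₀ hM] at this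
    linarith
  have hcomp : IsCompact (Icc (fun _ : ι ↦ -R) 0) := isCompact_Icc
  have h0 : (0 : ι → ℝ) ∈ Icc (fun _ : ι ↦ -R) 0 :=
    ⟨fun i ↦ neg_nonpos.2 (le_max_left _ _), le_rfl⟩
  obtain ⟨u, -, hu⟩ := hcomp.exists_isMinOn ⟨0, h0⟩ 
    (continuous_scalingFunctional (μ := μ) (ν := ν) hP).continuousOn
  refine ⟨u, fun w ↦ ?_⟩
  obtain ⟨i₁, hi₁⟩ := Finite.exists_max w
  rw [hΦ, ← scalingFunctional_sub_const hP hsum w (w i₁)]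
  set v : ι → ℝ := fun i ↦ w i - w i₁ with hv
  have hv0 : v ≤ 0 := fun i ↦ sub_nonpos.2 (hi₁ i)
  -- `max v = 0`, so either `v` lies in the box or some coordinate below `-R` makes `Φ v ≥ Φ 0`
  by_cases hvR : ∀ i, -R ≤ v i
  · exact hu ⟨hvR, hv0⟩
  · push Not at hvR
    obtain ⟨k, hk⟩ := hvR
    refine (hu h0).trans (hR.trans ?_)
    have h1 : B ≤ ∑ j, ν j * Real.log (∑ i, P i j * Real.exp (v i)) := by
      refine Finset.sum_le_sum fun j _ ↦ mul_le_mul_of_nonneg_left ?_ (hν j).le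
      refine Real.log_le_log hc ?_
      calc c ≤ P i₁ j * Real.exp (v i₁) := by simpa [hv] using hij (i₁, j)
        _ ≤ _ := Finset.single_le_sum (f := fun i ↦ P i j * Real.exp (v i))
          (fun i _ ↦ (mul_pos (hP i j) (Real.exp_pos _)).le) (Finset.mem_univ i₁)
    have h2 : M * R ≤ ∑ i, μ i * -v i :=
      calc M * R ≤ μ k * -v k := by
            refine mul_le_mul (hk₀ k) (by linarith) (le_max_left _ _) (hμ k).le
        _ ≤ _ := Finset.single_le_sum (f := fun i ↦ μ i * -v i)
          (fun i _ ↦ mul_nonneg (hμ i).le (neg_nonneg.2 (hv0 i))) (Finset.mem_univ k)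
    simp only [mul_neg, Finset.sum_neg_distrib] at h2
    simp only [scalingFunctional]
    linarith

/-- **Matrix scaling**: a positive matrix can be multiplied by positive row and column factors so as
to have prescribed positive row and column sums. The stationarity condition at a minimum of the dual
functional gives the row sums, the choice of `b` gives the column sums. -/
theorem exists_matrix_scaling [Nonempty ι] [Nonempty κ] (hP : ∀ i j, 0 < P i j)
    (hμ : ∀ i, 0 < μ i) (hν : ∀ j, 0 < ν j) (hsum : ∑ i, μ i = ∑ j, ν j) :
    ∃ (a : ι → ℝ) (b : κ → ℝ), (∀ i, 0 < a i) ∧ (∀ j, 0 < b j) ∧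
      (∀ i, a i * ∑ j, P i j * b j = μ i) ∧ ∀ j, b j * ∑ i, P i j * a i = ν j := by
  classical
  obtain ⟨u, hu⟩ := exists_forall_scalingFunctional_le hP hμ hν hsum
  set D : κ → ℝ := fun j ↦ ∑ i, P i j * Real.exp (u i) with hD
  have D0 : ∀ j, 0 < D j := sum_mul_exp_pos hP u
  refine ⟨fun i ↦ Real.exp (u i), fun j ↦ ν j / D j, fun i ↦ Real.exp_pos _,
    fun j ↦ div_pos (hν j) (D0 j), fun i ↦ ?_, fun j ↦ div_mul_cancel₀ _ (D0 j).ne'⟩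
  let e : ι → ℝ := Pi.single i 1
  have hd1 : ∀ k, HasDerivAt (fun t : ℝ ↦ u k + t * e k) (e k) 0 := fun k ↦ by
    simpa using ((hasDerivAt_id (0 : ℝ)).mul_const (e k)).const_add (u k)
  have hd2 : ∀ j, HasDerivAt (fun t : ℝ ↦ ∑ k, P k j * Real.exp (u k + t * e k))
      (P i j * Real.exp (u i)) 0 := fun j ↦ by
    have := HasDerivAt.fun_sum fun k (_ : k ∈ Finset.univ) ↦ ((hd1 k).exp.const_mul (P k j))
    refine this.congr_deriv ?_
    rw [Finset.sum_eq_single i (fun k _ hk ↦ by simp [e, hk]) (by simp)]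
    simp [e]
  have hd3 : HasDerivAt (fun t : ℝ ↦ scalingFunctional P μ ν fun k ↦ u k + t * e k)
      (∑ j, ν j * (P i j * Real.exp (u i) / D j) - μ i) 0 := by
    refine HasDerivAt.sub ?_ ?_
    · refine HasDerivAt.fun_sum fun j _ ↦ HasDerivAt.const_mul _ ?_
      have hne : ∑ k, P k j * Real.exp (u k + 0 * e k) ≠ 0 := by
        simpa using (D0 j).ne'
      simpa [hD] using (hd2 j).log hne
    · have := HasDerivAt.fun_sum fun k (_ : k ∈ Finset.univ) ↦ ((hd1 k).const_mul (μ k))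
      refine this.congr_deriv ?_
      rw [Finset.sum_eq_single i (fun k _ hk ↦ by simp [e, hk]) (by simp)]
      simp [e]
  have hmin : IsLocalMin (fun t : ℝ ↦ scalingFunctional P μ ν fun k ↦ u k + t * e k) 0 :=
    .of_forall fun t ↦ by simpa using hu _
  have hz := hmin.hasDerivAt_eq_zero hd3
  -- the vanishing partial derivative in `u i` is the equation for the `i`-th row sum
  rw [← sub_eq_zero, ← hz, Finset.mul_sum]
  congr 1
  exact Finset.sum_congr rfl fun j _ ↦ by ring

end Scaling

/-! ### Finitely supported marginals -/

section FiniteSupport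

variable {X Y : Type*} [MeasurableSpace X] [MeasurableSpace Y] [MeasurableSingletonClass X]
  [MeasurableSingletonClass Y]

/-- The atoms of positive mass carry a finitely supported measure. -/
lemma exists_finset_ae_mem_pos {μ : Measure X} {s : Finset X} (hs : ∀ᵐ x ∂μ, x ∈ s) :
    ∃ t : Finset X, (∀ᵐ x ∂μ, x ∈ t) ∧ ∀ x ∈ t, μ {x} ≠ 0 := by
  classical
  refine ⟨s.filter fun x ↦ μ {x} ≠ 0, ?_, fun x hx ↦ (Finset.mem_filter.1 hx).2⟩
  have h0 : μ (s.filter fun x ↦ μ {x} = 0 : Finset X) = 0 := by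
    rw [← sum_measure_singleton]
    exact Finset.sum_eq_zero fun x hx ↦ (Finset.mem_filter.1 hx).2
  filter_upwards [hs, measure_eq_zero_iff_ae_notMem.1 h0] with x hx hx'
  simp only [Finset.coe_filter, mem_ofPred_eq, not_and] at hx'
  exact Finset.mem_filter.2 ⟨hx, hx' hx⟩

lemma lintegral_eq_sum_of_ae_mem_finset {μ : Measure X} {s : Finset X} (hs : ∀ᵐ x ∂μ, x ∈ s)
    (f : X → ℝ≥0∞) : ∫⁻ x, f x ∂μ = ∑ x : s, f x * μ {(x : X)} := by
  have : μ.restrict s = μ := Measure.restrict_eq_self_of_ae_mem hs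
  rw [Finset.sum_coe_sort s fun x ↦ f x * μ {x}, ← lintegral_finset, this]

/-- Existence for finitely supported marginals, from matrix scaling. -/
lemma exists_isSchrodingerSolution_of_finite {p : X → Y → ℝ≥0∞}
    (hp : Measurable (Function.uncurry p)) (h0 : ∀ x y, p x y ≠ 0) (htop : ∀ x y, p x y ≠ ∞)
    {μ : Measure X} {ν : Measure Y} [IsProbabilityMeasure μ] [IsProbabilityMeasure ν]
    {s : Finset X} {t : Finset Y} (hs : ∀ᵐ x ∂μ, x ∈ s) (ht : ∀ᵐ y ∂ν, y ∈ t) :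
    ∃ a b, IsSchrodingerSolution p μ ν a b := by
  classical
  obtain ⟨s, hs, hs0⟩ := exists_finset_ae_mem_pos hs
  obtain ⟨t, ht, ht0⟩ := exists_finset_ae_mem_pos ht
  have : Nonempty s := let ⟨x, hx⟩ := hs.exists; ⟨⟨x, hx⟩⟩
  have : Nonempty t := let ⟨x, hx⟩ := ht.exists; ⟨⟨x, hx⟩⟩
  have sum_μ : ∑ x : s, μ.real {(x : X)} = 1 := by
    have := lintegral_eq_sum_of_ae_mem_finset hs fun _ ↦ 1
    simp only [lintegral_one, measure_univ, one_mul] at this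
    simp only [Measure.real]
    rw [← ENNReal.toReal_sum (fun _ _ ↦ measure_ne_top _ _), ← this, ENNReal.toReal_one]
  have sum_ν : ∑ x : t, ν.real {(x : Y)} = 1 := by
    have := lintegral_eq_sum_of_ae_mem_finset ht fun _ ↦ 1
    simp only [lintegral_one, measure_univ, one_mul] at this
    simp only [Measure.real]
    rw [← ENNReal.toReal_sum (fun _ _ ↦ measure_ne_top _ _), ← this, ENNReal.toReal_one]
  have μ0 : ∀ x : s, 0 < μ.real {(x : X)} := fun x ↦
    ENNReal.toReal_pos (hs0 x x.2) (measure_ne_top _ _)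
  have ν0 : ∀ x : t, 0 < ν.real {(x : Y)} := fun x ↦
    ENNReal.toReal_pos (ht0 x x.2) (measure_ne_top _ _)
  obtain ⟨α, β, α0, β0, hα, hβ⟩ := exists_matrix_scaling (P := fun (x : s) (y : t) ↦ (p x y).toReal)
    (fun x y ↦ ENNReal.toReal_pos (h0 _ _) (htop _ _)) μ0 ν0 (by rw [sum_μ, sum_ν])
  let a : Measure X := ∑ x : s, ENNReal.ofReal (α x) • Measure.dirac (x : X)
  let b : Measure Y := ∑ y : t, ENNReal.ofReal (β y) • Measure.dirac (y : Y)
  have la : ∀ f : X → ℝ≥0∞, ∫⁻ x, f x ∂a = ∑ x : s, ENNReal.ofReal (α x) * f x := fun f ↦ by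
    simp [a, lintegral_finsetSum_measure]
  have lb : ∀ f : Y → ℝ≥0∞, ∫⁻ y, f y ∂b = ∑ y : t, ENNReal.ofReal (β y) * f y := fun f ↦ by
    simp [b, lintegral_finsetSum_measure]
  have fa : IsFiniteMeasure a := ⟨by
    rw [← lintegral_one, la]; simp [ENNReal.sum_lt_top]⟩
  have fb : IsFiniteMeasure b := ⟨by
    rw [← lintegral_one, lb]; simp [ENNReal.sum_lt_top]⟩
  have hp' : Measurable fun z : X × Y ↦ p z.1 z.2 := hp
  refine ⟨a, b, inferInstance, inferInstance, ?_, ?_⟩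
  · refine Measure.ext_of_lintegral _ fun f hf ↦ ?_
    rw [lintegral_withDensity_eq_lintegral_mul _ hp'.lintegral_prod_right' hf, la,
      lintegral_eq_sum_of_ae_mem_finset hs]
    refine Finset.sum_congr rfl fun x _ ↦ ?_
    rw [Pi.mul_apply, ← mul_assoc, lb, mul_comm]
    congr 1
    rw [← ENNReal.ofReal_toReal (measure_ne_top μ {(x : X)})]
    change _ = ENNReal.ofReal (μ.real _)
    rw [← hα x, ENNReal.ofReal_mul (α0 x).le, ENNReal.ofReal_sum_of_nonneg
      fun y _ ↦ mul_nonneg ENNReal.toReal_nonneg (β0 y).le]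
    congr 1
    refine Finset.sum_congr rfl fun y _ ↦ ?_
    rw [mul_comm, ENNReal.ofReal_mul ENNReal.toReal_nonneg, ENNReal.ofReal_toReal (htop _ _)]
  · refine Measure.ext_of_lintegral _ fun f hf ↦ ?_
    rw [lintegral_withDensity_eq_lintegral_mul _ hp'.lintegral_prod_left' hf, lb,
      lintegral_eq_sum_of_ae_mem_finset ht]
    refine Finset.sum_congr rfl fun y _ ↦ ?_
    rw [Pi.mul_apply, ← mul_assoc, la, mul_comm]
    congr 1
    rw [← ENNReal.ofReal_toReal (measure_ne_top ν {(y : Y)})]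
    change _ = ENNReal.ofReal (ν.real _)
    rw [← hβ y, ENNReal.ofReal_mul (β0 y).le, ENNReal.ofReal_sum_of_nonneg
      fun x _ ↦ mul_nonneg ENNReal.toReal_nonneg (α0 x).le]
    congr 1
    refine Finset.sum_congr rfl fun x _ ↦ ?_
    rw [mul_comm, ENNReal.ofReal_mul ENNReal.toReal_nonneg, ENNReal.ofReal_toReal (htop _ _)]

end FiniteSupport

/-! ### Finitely supported approximation, tightness and weak limits -/

section WeakLimit

open BoundedContinuousFunction

/-- Borel probability measures are weak limits of finitely supported ones: push `μ` forward along
simple functions converging pointwise to the identity. -/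
lemma exists_tendsto_finite_support {X : Type*} [MetricSpace X] [MeasurableSpace X]
    [BorelSpace X] [SecondCountableTopology X] (μ : ProbabilityMeasure X) :
    ∃ μs : ℕ → ProbabilityMeasure X,
      (∀ n, ∃ s : Finset X, ∀ᵐ x ∂(μs n : Measure X), x ∈ s) ∧ Tendsto μs atTop (𝓝 μ) := by
  obtain ⟨x₀⟩ : Nonempty X := μ.nonempty
  let f : ℕ → SimpleFunc X X := SimpleFunc.approxOn id measurable_id univ x₀ (mem_univ _)
  refine ⟨fun n ↦ μ.map (f n).measurable.aemeasurable, fun n ↦ ⟨(f n).range, ?_⟩, ?_⟩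
  · exact (ae_map_iff (f n).measurable.aemeasurable (Finset.measurableSet (f n).range)).2
      (.of_forall fun x ↦ (f n).mem_range_self x)
  · rw [ProbabilityMeasure.tendsto_iff_forall_lintegral_tendsto]
    intro g
    have hg : Measurable fun x ↦ (g x : ℝ≥0∞) := (measurable_coe_nnreal_ennreal.comp
      g.continuous.measurable)
    simp only [ProbabilityMeasure.toMeasure_map, lintegral_map hg (f _).measurable]
    refine tendsto_lintegral_of_dominated_convergence (fun _ ↦ ((nndist g 0 : ℝ≥0) : ℝ≥0∞))
      (fun n ↦ hg.comp (f n).measurable) (fun n ↦ .of_forall fun x ↦ ?_) (by simp)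
      (.of_forall fun x ↦ ?_)
    · exact ENNReal.coe_le_coe.2 (NNReal.upper_bound g _)
    · have : Tendsto (fun n ↦ f n x) atTop (𝓝 x) :=
        SimpleFunc.tendsto_approxOn measurable_id (mem_univ _) (by simp)
      exact (ENNReal.continuous_coe.comp g.continuous).continuousAt.tendsto.comp this

lemma isTightMeasureSet_of_tendsto {X : Type*} [MetricSpace X] [MeasurableSpace X]
    [BorelSpace X] [SecondCountableTopology X] [CompleteSpace X] {μs : ℕ → ProbabilityMeasure X}
    {μ : ProbabilityMeasure X} (h : Tendsto μs atTop (𝓝 μ)) :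
    IsTightMeasureSet {((ρ : ProbabilityMeasure X) : Measure X) | ρ ∈ range μs} :=
  isTightMeasureSet_of_isCompact_closure
    (h.isCompact_insert_range.closure_of_subset (subset_insert _ _))

variable {X Y : Type*} [MeasurableSpace X] [MeasurableSpace Y]

lemma isTightMeasureSet_of_marginals [TopologicalSpace X] [TopologicalSpace Y] [T2Space X]
    [T2Space Y] [OpensMeasurableSpace X] [OpensMeasurableSpace Y]
    {S : Set (Measure (X × Y))}
    (h1 : IsTightMeasureSet ((fun π ↦ π.map Prod.fst) '' S))
    (h2 : IsTightMeasureSet ((fun π ↦ π.map Prod.snd) '' S)) : IsTightMeasureSet S := by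
  rw [isTightMeasureSet_iff_exists_isCompact_measure_compl_le] at h1 h2 ⊢
  intro ε hε
  obtain ⟨K, hK, hK1⟩ := h1 (ε / 2) (ENNReal.half_pos hε.ne')
  obtain ⟨K', hK', hK2⟩ := h2 (ε / 2) (ENNReal.half_pos hε.ne')
  refine ⟨K ×ˢ K', hK.prod hK', fun π hπ ↦ ?_⟩
  have e1 := hK1 _ ⟨π, hπ, rfl⟩
  have e2 := hK2 _ ⟨π, hπ, rfl⟩
  rw [Measure.map_apply measurable_fst hK.measurableSet.compl] at e1
  rw [Measure.map_apply measurable_snd hK'.measurableSet.compl] at e2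
  calc π (K ×ˢ K')ᶜ ≤ π (Prod.fst ⁻¹' Kᶜ ∪ Prod.snd ⁻¹' K'ᶜ) := by
        refine measure_mono fun z hz ↦ ?_
        simp only [mem_compl_iff, mem_prod, mem_union, mem_preimage] at hz ⊢
        tauto
    _ ≤ ε / 2 + ε / 2 := (measure_union_le _ _).trans (add_le_add e1 e2)
    _ = ε := ENNReal.add_halves ε

variable [MetricSpace X] [MetricSpace Y] [BorelSpace X] [BorelSpace Y]
  [SecondCountableTopology X] [SecondCountableTopology Y]

/-- For a bounded continuous kernel, being swap-balanced passes to weak limits. -/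
lemma SwapBalanced.of_tendsto {q : X → Y → ℝ≥0} (hq : Continuous (Function.uncurry q)) {C : ℝ≥0}
    (hC : ∀ x y, q x y ≤ C) {ι : Type*} {F : Filter ι} [F.NeBot]
    {πs : ι → ProbabilityMeasure (X × Y)} {π : ProbabilityMeasure (X × Y)}
    (hlim : Tendsto πs F (𝓝 π))
    (h : ∀ i, SwapBalanced (fun x y ↦ (q x y : ℝ≥0∞)) (πs i : Measure (X × Y))) :
    SwapBalanced (fun x y ↦ (q x y : ℝ≥0∞)) (π : Measure (X × Y)) := by
  have hprod : Tendsto (fun i ↦ (πs i).prod (πs i)) F (𝓝 (π.prod π)) :=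
    (ProbabilityMeasure.continuous_prod.tendsto (π, π)).comp (hlim.prodMk_nhds hlim)
  rw [ProbabilityMeasure.tendsto_iff_forall_lintegral_tendsto] at hprod
  have hm : Measurable (crossWeight fun x y ↦ (q x y : ℝ≥0∞)) :=
    measurable_crossWeight (measurable_coe_nnreal_ennreal.comp hq.measurable)
  have hWc : Continuous fun w : (X × Y) × (X × Y) ↦ q w.1.1 w.2.2 * q w.2.1 w.1.2 :=
    (hq.comp (f := fun w : (X × Y) × (X × Y) ↦ (w.1.1, w.2.2)) (by fun_prop)).mul
      (hq.comp (f := fun w : (X × Y) × (X × Y) ↦ (w.2.1, w.1.2)) (by fun_prop))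
  have hWb : ∀ w : (X × Y) × (X × Y), q w.1.1 w.2.2 * q w.2.1 w.1.2 ≤ C * C := fun w ↦
    mul_le_mul' (hC _ _) (hC _ _)
  let W : (X × Y) × (X × Y) →ᵇ ℝ≥0 := .mkOfBound ⟨_, hWc⟩ (C * C : ℝ≥0) fun w w' ↦ by
    rw [NNReal.dist_eq, abs_sub_le_iff]
    have := NNReal.coe_le_coe.2 (hWb w)
    have := NNReal.coe_le_coe.2 (hWb w')
    have := NNReal.coe_nonneg (q w.1.1 w.2.2 * q w.2.1 w.1.2)
    have := NNReal.coe_nonneg (q w'.1.1 w'.2.2 * q w'.2.1 w'.1.2)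
    constructor <;> simp only [ContinuousMap.coe_mk] <;> linarith
  have hsw : Continuous (swapSnd : (X × Y) × (X × Y) → (X × Y) × (X × Y)) := by
    unfold swapSnd; fun_prop
  have lint : ∀ (π : ProbabilityMeasure (X × Y)) (G : (X × Y) × (X × Y) →ᵇ ℝ≥0),
      ∫⁻ w, G w ∂((π : Measure (X × Y)).prod π).withDensity (crossWeight fun x y ↦ (q x y : ℝ≥0∞)) =
        ∫⁻ w, (W * G) w ∂(π.prod π : ProbabilityMeasure _).toMeasure := fun π G ↦ by
    have hG : Measurable fun w ↦ (G w : ℝ≥0∞) :=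
      measurable_coe_nnreal_ennreal.comp G.continuous.measurable
    rw [lintegral_withDensity_eq_lintegral_mul _ hm hG]
    refine lintegral_congr fun w ↦ ?_
    simp [W, crossWeight]
  have lintswap : ∀ (Q : Measure ((X × Y) × (X × Y))) (G : (X × Y) × (X × Y) →ᵇ ℝ≥0),
      ∫⁻ w, G w ∂Q.map swapSnd = ∫⁻ w, (G.compContinuous ⟨swapSnd, hsw⟩) w ∂Q := fun Q G ↦ by
    have hG : Measurable fun w ↦ (G w : ℝ≥0∞) :=
      measurable_coe_nnreal_ennreal.comp G.continuous.measurable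
    rw [lintegral_map hG measurable_swapSnd]
    rfl
  have fin : IsFiniteMeasure (((π : Measure (X × Y)).prod π).withDensity
      (crossWeight fun x y ↦ (q x y : ℝ≥0∞))) := by
    refine isFiniteMeasure_withDensity ?_
    refine ((lintegral_mono (g := fun _ ↦ ((C * C : ℝ≥0) : ℝ≥0∞)) fun w ↦ ?_).trans_lt ?_).ne
    · have := ENNReal.coe_le_coe.2 (hWb w)
      simpa [crossWeight] using this
    · simp [ENNReal.mul_lt_top]
  refine (ext_of_forall_lintegral_eq_of_IsFiniteMeasure fun G ↦ ?_).symm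
  rw [lintswap, lint, lint]
  refine tendsto_nhds_unique (hprod _) ((hprod _).congr fun i ↦ ?_)
  rw [← lint, ← lint, ← lintswap, h i]

end WeakLimit

/-! ### Existence -/

section Existence

variable {X Y : Type*} [MeasurableSpace X] [MeasurableSpace Y]
  [MetricSpace X] [MetricSpace Y] [BorelSpace X] [BorelSpace Y]
  [CompleteSpace X] [CompleteSpace Y] [SecondCountableTopology X] [SecondCountableTopology Y]

/-- Existence, for a bounded continuous positive kernel on σ-compact Polish spaces. -/
theorem exists_isSchrodingerSolution [SigmaCompactSpace X] [SigmaCompactSpace Y]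
    {q : X → Y → ℝ≥0} (hq : Continuous (Function.uncurry q))
    {C : ℝ≥0} (hC : ∀ x y, q x y ≤ C) (hpos : ∀ x y, 0 < q x y)
    (μ : Measure X) (ν : Measure Y) [IsProbabilityMeasure μ] [IsProbabilityMeasure ν] :
    ∃ a b, IsSchrodingerSolution (fun x y ↦ (q x y : ℝ≥0∞)) μ ν a b := by
  set p : X → Y → ℝ≥0∞ := fun x y ↦ (q x y : ℝ≥0∞) with hpdef
  have hp : Measurable (Function.uncurry p) := measurable_coe_nnreal_ennreal.comp hq.measurable
  have h0 : ∀ x y, p x y ≠ 0 := fun x y ↦ by simpa [p] using (hpos x y).ne'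
  have htop : ∀ x y, p x y ≠ ∞ := fun x y ↦ ENNReal.coe_ne_top
  obtain ⟨μs, hμf, hμ⟩ := exists_tendsto_finite_support (⟨μ, ‹_›⟩ : ProbabilityMeasure X)
  obtain ⟨νs, hνf, hν⟩ := exists_tendsto_finite_support (⟨ν, ‹_›⟩ : ProbabilityMeasure Y)
  have hsol : ∀ n, ∃ π : ProbabilityMeasure (X × Y), SwapBalanced p (π : Measure (X × Y)) ∧
      (π : Measure (X × Y)).map Prod.fst = μs n ∧ (π : Measure (X × Y)).map Prod.snd = νs n := by
    intro n
    obtain ⟨s, hs⟩ := hμf n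
    obtain ⟨t, ht⟩ := hνf n
    obtain ⟨a, b, hab⟩ := exists_isSchrodingerSolution_of_finite hp h0 htop hs ht
    have := hab.sigmaFinite_left; have := hab.sigmaFinite_right
    exact ⟨⟨_, hab.isProbabilityMeasure hp⟩, swapBalanced_schrodingerMeasure hp a b,
      hab.map_fst hp, hab.map_snd hp⟩
  choose πs hsb hfst hsnd using hsol
  have tight : IsTightMeasureSet {((ρ : ProbabilityMeasure (X × Y)) : Measure (X × Y)) |
      ρ ∈ range πs} := by
    refine isTightMeasureSet_of_marginals ((isTightMeasureSet_of_tendsto hμ).subset ?_)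
      ((isTightMeasureSet_of_tendsto hν).subset ?_)
    · rintro _ ⟨_, ⟨_, ⟨n, rfl⟩, rfl⟩, rfl⟩
      exact ⟨μs n, ⟨n, rfl⟩, (hfst n).symm⟩
    · rintro _ ⟨_, ⟨_, ⟨n, rfl⟩, rfl⟩, rfl⟩
      exact ⟨νs n, ⟨n, rfl⟩, (hsnd n).symm⟩
  -- a limit along an ultrafilter finer than `atTop` avoids passing to subsequences
  obtain ⟨π, -, hπ⟩ := (isCompact_closure_of_isTightMeasureSet tight).ultrafilter_le_nhds
    ((hyperfilter ℕ).map πs) (by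
      rw [le_principal_iff]
      exact mem_of_superset (Filter.mem_map.2 (univ_mem' fun n ↦ mem_range_self n)) subset_closure)
  have hlim : Tendsto πs (hyperfilter ℕ : Filter ℕ) (𝓝 π) := hπ
  have hle : (hyperfilter ℕ : Filter ℕ) ≤ atTop := Nat.hyperfilter_le_atTop
  have hπsb : SwapBalanced p (π : Measure (X × Y)) := SwapBalanced.of_tendsto hq hC hlim hsb
  have hπ1 : (π : Measure (X × Y)).map Prod.fst = μ := by
    have l1 := ProbabilityMeasure.tendsto_map_of_tendsto_of_continuous πs π hlim continuous_fst
    have l2 := (hμ.mono_left hle).congr fun n ↦ show μs n = (πs n).map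
      continuous_fst.measurable.aemeasurable from Subtype.ext (hfst n).symm
    have e := tendsto_nhds_unique l1 l2
    exact congrArg ProbabilityMeasure.toMeasure e
  have hπ2 : (π : Measure (X × Y)).map Prod.snd = ν := by
    have l1 := ProbabilityMeasure.tendsto_map_of_tendsto_of_continuous πs π hlim continuous_snd
    have l2 := (hν.mono_left hle).congr fun n ↦ show νs n = (πs n).map
      continuous_snd.measurable.aemeasurable from Subtype.ext (hsnd n).symm
    have e := tendsto_nhds_unique l1 l2
    exact congrArg ProbabilityMeasure.toMeasure e
  have hfin : ∀ i j, (π : Measure (X × Y)).withDensity (fun z ↦ (p z.1 z.2)⁻¹)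
      (compactCovering X i ×ˢ compactCovering Y j) ≠ ∞ := by
    intro i j
    have hK := (isCompact_compactCovering X i).prod (isCompact_compactCovering Y j)
    rw [withDensity_apply _ hK.measurableSet]
    have hc : Continuous fun z : X × Y ↦ (q z.1 z.2)⁻¹ :=
      Continuous.inv₀ hq fun z ↦ (hpos _ _).ne'
    obtain ⟨M, hM⟩ := (hK.image hc).bddAbove
    refine ((setLIntegral_mono (g := fun _ ↦ (M : ℝ≥0∞)) measurable_const fun z hz ↦ ?_).trans_lt
      ?_).ne
    · rw [hpdef, ← ENNReal.coe_inv (hpos _ _).ne']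
      exact ENNReal.coe_le_coe.2 (hM ⟨z, hz, rfl⟩)
    · simp [ENNReal.mul_lt_top, measure_lt_top]
  obtain ⟨a, b, ha, hb, hab⟩ := hπsb.exists_eq_schrodingerMeasure hp h0 htop
    (fun n ↦ (isCompact_compactCovering X n).measurableSet)
    (fun n ↦ (isCompact_compactCovering Y n).measurableSet)
    (iUnion_compactCovering X) (iUnion_compactCovering Y) hfin (IsProbabilityMeasure.ne_zero _)
  exact ⟨a, b, (isSchrodingerSolution_iff_map hp).2 ⟨hab ▸ hπ1, hab ▸ hπ2⟩⟩

end Existence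

/-! ### Radial kernels -/

theorem mainTheorem3 (n : ℕ) (θ : ℝ → ℝ)
    (hpos : ∀ r : ℝ, 0 ≤ r → 0 < θ r)
    (hbdd : ∃ C : ℝ, ∀ r : ℝ, 0 ≤ r → θ r ≤ C)
    (hcont : ContinuousOn θ (Ici 0))
    (hanti : ∃ L : ℝ, 0 ≤ L ∧ AntitoneOn θ (Ici L))
    (μ ν : Measure (EuclideanSpace ℝ (Fin n))) [IsProbabilityMeasure μ] [IsProbabilityMeasure ν] :
    (∃ a b : Measure (EuclideanSpace ℝ (Fin n)),
      IsSchrodingerSolution (radialDensity n θ) μ ν a b ∧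
      ∀ a' b' : Measure (EuclideanSpace ℝ (Fin n)),
        IsSchrodingerSolution (radialDensity n θ) μ ν a' b' ↔
          ∃ κ : ℝ≥0, 0 < κ ∧ a' = κ⁻¹ • a ∧ b' = κ • b) ∧
    (∃! π : Measure (EuclideanSpace ℝ (Fin n) × EuclideanSpace ℝ (Fin n)),
      ∃ a b : Measure (EuclideanSpace ℝ (Fin n)),
        IsSchrodingerSolution (radialDensity n θ) μ ν a b ∧
        π = schrodingerMeasure (radialDensity n θ) a b) := by
  set p := radialDensity n θ with hpdef
  let q : EuclideanSpace ℝ (Fin n) → EuclideanSpace ℝ (Fin n) → ℝ≥0 :=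
    fun x y ↦ (θ ‖y - x‖).toNNReal
  have hpq : p = fun x y ↦ (q x y : ℝ≥0∞) := rfl
  have hq : Continuous (Function.uncurry q) := by
    refine continuous_real_toNNReal.comp ?_
    exact hcont.comp_continuous (f := fun z : EuclideanSpace ℝ (Fin n) × EuclideanSpace ℝ (Fin n) ↦
      ‖z.2 - z.1‖) (by fun_prop) fun z ↦ norm_nonneg _
  have q0 : ∀ x y, 0 < q x y := fun x y ↦ Real.toNNReal_pos.2 (hpos _ (norm_nonneg _))
  have hp : Measurable (Function.uncurry p) := measurable_coe_nnreal_ennreal.comp hq.measurable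
  have h0 : ∀ x y, p x y ≠ 0 := fun x y ↦ ENNReal.coe_ne_zero.2 (q0 x y).ne'
  have htop : ∀ x y, p x y ≠ ∞ := fun x y ↦ ENNReal.coe_ne_top
  obtain ⟨C, hC⟩ := hbdd
  obtain ⟨a, b, hab⟩ := exists_isSchrodingerSolution hq (C := C.toNNReal)
    (fun x y ↦ Real.toNNReal_le_toNNReal (hC _ (norm_nonneg _))) q0 μ ν
  have := hab.sigmaFinite_left; have := hab.sigmaFinite_right
  refine ⟨⟨a, b, hab, fun a' b' ↦ ⟨fun h' ↦ hab.exists_smul_eq h' hp h0 htop, ?_⟩⟩,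
    schrodingerMeasure p a b, ⟨a, b, hab, rfl⟩, ?_⟩
  · rintro ⟨κ, hκ, rfl, rfl⟩
    exact hab.smul hp hκ
  · rintro _ ⟨a', b', h', rfl⟩
    obtain ⟨κ, hκ, rfl, rfl⟩ := hab.exists_smul_eq h' hp h0 htop
    exact schrodingerMeasure_smul_smul hκ
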